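/- **Setting.** A network has $n+1$ nodes, a dealer $D$ and $n$ participants; it is a directed graph (an undirected link is a pair of opposite edges) whose edges are secure private links. $\mathcal N(D)$ is the set of participants with an incoming edge from $D$. A network satisfies the *$m$-propagating-dealer condition* if the participants can be ordered so that each of them is in $\mathcal N(D)$ or has incoming edges from at least $m$ participants preceding it. An algorithm performs *$(n,k)$ secret sharing* on a network if, with a non-deterministic secret held by the dealer, any $k$ participants can together recover the secret from their data, and the data of fewer than $k$ participants is independent of the secret. One unit of data is the size of the secret. The communication $\Gamma$ of a concrete scheme is the total number of field symbols sent over links, in units; that of an arbitrary algorithm (any number of rounds, private randomness at every node) is the sum over all links of the entropy of the data passed over the link, divided by the entropy of the secret. *SNEAK with parameter $d\ge k$*: the secret is a vector in $\mathbb F_q^{\,d-k+1}$, $q>n$; participant $i$ has an encoding vector $\psi_i=(1,x_i,\dots,x_i^{d-1})^T$ with distinct nonzero $x_i\in\mathbb F_q$; the dealer forms the symmetric $d\times d$ matrix $$M=\begin{pmatrix}S_A&R_a^T&S_B^T\\R_a&R_b&R_c^T\\S_B&R_c&0\end{pmatrix}$$ (blocks of sizes $1,k-1,d-k$), where $S_A,S_B$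 contain the secret and $R_a,R_b=R_b^T,R_c$ are random, and sends $\psi_j^TM$ to each $j\in\mathcal N(D)$. A participant outside $\mathcal N(D)$ waits for one value from each of $d$ neighbours and computes from them, by inverting a Vandermonde matrix, the vector $v=M\psi_\ell$; a participant holding its vector $v$ passes $v^T\psi_j$ to each out-neighbour $j\notin\mathcal N(D)$ that has not yet received $d$ values. The transmissions may take place in any order. *The state-of-the-art scheme (sota)*: each participant in $\mathcal N(D)$ gets its Shamir share (one unit) directly. For every other participant $i$ the dealer chooses $w\ge k$ node-disjoint paths to $i$, encodes the share of $i$ by two-threshold secret sharing into $w$ chunks of $\frac1{w-k+1}$ units each, and passes one chunk along each path; $w$ and the paths are chosen so that the communication is minimal ($\Gamma_{\rm sota}=\infty$ if for some such $i$ there are no $k$ node-disjoint paths). **Theorem.** Let $2\le k\le d$ be fixed. 1. There are constants $c,C,K>0$ depending only on $k$ and $d$ such that for all $n\ge k$ and every network with $n$ participants satisfying the $d$-propagating-dealer condition (for $d=k$: the $k$-propagating-dealer condition), SNEAK with parameter $d$ has a complete execution, and every complete execution has communication $\Gamma_{\rm SNEAK}$ with $c\,n\le\Gamma_{\rm SNEAK}\le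 C\,n$ and $\Gamma_{\rm SNEAK}\le K\,\Gamma_{\rm any}$ for every algorithm that performs $(n,k)$ secret sharing on this network. 2. Let $\varepsilon>0$ and let $(\mathcal G_m)$ be a sequence of networks with $n_m\to\infty$ participants and maximum outgoing degree $O\big((\log n_m)^{1/2-\varepsilon}\big)$. Then $\Gamma_{\rm sota}(\mathcal G_m)$ is super-linear: $\Gamma_{\rm sota}(\mathcal G_m)/n_m\to\infty$. 3. There is a class of networks, containing for every $n>d$ at least one network with $n$ participants, such that every network of the class with $n>d$ participants satisfies the $d$-propagating-dealer condition and has $c'n^2\le\Gamma_{\rm sota}\le C'n^2$, where $c',C'>0$ depend only on $k$ and $d$. -/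

import Mathlib

open Filter Topology Asymptotics
open scoped NNReal ENNReal

namespace SecretSharing

/-! ## Networks -/

/-- A network with `n` participants: node `none` is the dealer, node `some i` is participant `i`.
An undirected link is a pair of opposite edges. -/
abbrev Network (n : ℕ) := Digraph (Option (Fin n))

/-- Participant `i` is directly connected to the dealer. -/
def Direct {n : ℕ} (G : Network n) (i : Fin n) : Prop := G.Adj none (some i)

/-- The `m`-propagating-dealer condition: for some ordering of the participants, each of them has
an incoming edge from the dealer, or incoming edges from at least `m` participants preceding it. -/
def PropagatingDealer {n : ℕ} (G : Network n) (m : ℕ) : Prop :=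
  ∃ rank : Fin n ≃ Fin n, ∀ i : Fin n,
    Direct G i ∨ m ≤ {j : Fin n | rank j < rank i ∧ G.Adj (some j) (some i)}.ncard

/-- The maximum outgoing degree, over all nodes including the dealer. -/
noncomputable def maxOutDegree {n : ℕ} (G : Network n) : ℕ :=
  Finset.univ.sup fun u : Option (Fin n) => {v | G.Adj u v}.ncard

/-- A transmission over one link, carrying a list of field symbols. -/
structure Message (n : ℕ) (F : Type) where
  src : Option (Fin n)
  dst : Option (Fin n)
  payload : List F

/-- The total number of field symbols transmitted. -/
def symbols {n : ℕ} {F : Type} (log : List (Message n F)) : ℕ :=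
  (log.map fun m => m.payload.length).sum

/-! ## The SNEAK algorithm -/

/-- The data of an instance of SNEAK: a finite field, distinct nonzero evaluation points of the
participants (so that the field has more than `n` elements), the secret, which consists of
`d - k + 1` field symbols, and the values of the random symbols drawn by the dealer. -/
structure SneakSetup (n k d : ℕ) where
  one_le : 1 ≤ k
  le : k ≤ d
  F : Type
  [field : Field F]
  [fintype : Fintype F]
  point : Fin n → F
  point_injective : Function.Injective point
  point_ne_zero : ∀ i, point i ≠ 0
  secret : Fin (d - k + 1) → F
  Ra : Fin (k - 1) → F
  Rb : Matrix (Fin (k - 1)) (Fin (k - 1)) F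
  Rb_symm : Rb.IsSymm
  Rc : Matrix (Fin (d - k)) (Fin (k - 1)) F

attribute [instance] SneakSetup.field SneakSetup.fintype

namespace SneakSetup

variable {n k d : ℕ} (S : SneakSetup n k d)

/-- `S_A`, the last symbol of the secret. -/
def SA : S.F := S.secret (Fin.last (d - k))

/-- `S_B`, the first `d - k` symbols of the secret. -/
def SB : Fin (d - k) → S.F := fun j => S.secret j.castSucc

/-- The position of the blocks of sizes `1`, `k - 1`, `d - k` in `{0, …, d - 1}`. -/
def blockEquiv : Fin 1 ⊕ (Fin (k - 1) ⊕ Fin (d - k)) ≃ Fin d :=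
  ((Equiv.refl (Fin 1)).sumCongr finSumFinEquiv).trans
    (finSumFinEquiv.trans (finCongr (by have := S.one_le; have := S.le; omega)))

/-- The symmetric `d × d` matrix with blocks
`[S_A, R_aᵀ, S_Bᵀ; R_a, R_b, R_cᵀ; S_B, R_c, 0]`. -/
def M : Matrix (Fin d) (Fin d) S.F :=
  Matrix.reindex S.blockEquiv S.blockEquiv
    (Matrix.fromBlocks
      (Matrix.of fun _ _ => S.SA)
      (Matrix.fromCols (Matrix.replicateRow (Fin 1) S.Ra) (Matrix.replicateRow (Fin 1) S.SB))
      (Matrix.fromRows (Matrix.replicateCol (Fin 1) S.Ra) (Matrix.replicateCol (Fin 1) S.SB))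
      (Matrix.fromBlocks S.Rb S.Rc.transpose S.Rc 0))

/-- The encoding vector `(1, x_i, x_i ^ 2, …, x_i ^ (d - 1))` of participant `i`. -/
def psi (i : Fin n) : Fin d → S.F := fun j => S.point i ^ (j : ℕ)

/-- After the transmissions in `log`, participant `i` holds the vector `v`: it has received `v`
from the dealer, or it is not connected to the dealer and has computed `v` from one value from
each of `d` distinct neighbours. -/
inductive Holds (G : Network n) (log : List (Message n S.F)) (i : Fin n) : (Fin d → S.F) → Prop
  | dealt (v : Fin d → S.F) (hv : Message.mk none (some i) (List.ofFn v) ∈ log) :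
      Holds G log i v
  | solved (hi : ¬ Direct G i) (nb : Fin d → Fin n) (hnb : Function.Injective nb)
      (σ : Fin d → S.F)
      (hσ : ∀ a, Message.mk (some (nb a)) (some i) [σ a] ∈ log) :
      Holds G log i ((Matrix.of fun a => S.psi (nb a))⁻¹.mulVec σ)

/-- One transmission of the algorithm. The dealer passes `ψ_jᵀ M` to a neighbour `j`, once.
A participant `i` holding a vector `v` passes `vᵀ ψ_j` to a neighbour `j`, once, provided that
`j` still requires data (handshake): `j` is not connected to the dealer and has received fewer
than `d` values. In particular nothing is passed back to a neighbour from whom data came. -/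
inductive Step (G : Network n) : List (Message n S.F) → List (Message n S.F) → Prop
  | deal (log : List (Message n S.F)) (j : Fin n) (hj : Direct G j)
      (hfresh : ∀ m ∈ log, ¬ (m.src = none ∧ m.dst = some j)) :
      Step G log (Message.mk none (some j) (List.ofFn (Matrix.vecMul (S.psi j) S.M)) :: log)
  | pass (log : List (Message n S.F)) (i j : Fin n) (v : Fin d → S.F)
      (hij : G.Adj (some i) (some j)) (hv : S.Holds G log i v)
      (hj : ¬ Direct G j)
      (hneed : log.countP (fun m => decide (m.dst = some j)) < d)
      (hfresh : ∀ m ∈ log, ¬ (m.src = some i ∧ m.dst = some j)) :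
      Step G log (Message.mk (some i) (some j) [v ⬝ᵥ S.psi j] :: log)

/-- `log` (latest transmission first) is the record of a completed execution: it arises from the
empty record by steps of the algorithm, in any order, and no further step is possible. -/
def CompleteRun (G : Network n) (log : List (Message n S.F)) : Prop :=
  Relation.ReflTransGen (S.Step G) [] log ∧ ∀ log', ¬ S.Step G log log'

/-- Communication of an execution, in units of the size of the secret (`d - k + 1` symbols). -/
noncomputable def comm (log : List (Message n S.F)) : ℝ :=
  (symbols log : ℝ) / ((d - k + 1 : ℕ) : ℝ)

end SneakSetup

/-! ## Arbitrary secret sharing algorithms -/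

/-- Shannon entropy (in nats) of the random variable `X` on the finite probability space with
point masses `p`. -/
noncomputable def entropy {Ω α : Type*} [Fintype Ω] (p : Ω → ℝ) (X : Ω → α) : ℝ :=
  open Classical in
  ∑ x ∈ Finset.univ.image X, Real.negMulLog (∑ ω ∈ Finset.univ.filter (fun ω => X ω = x), p ω)

/-- Probability of an event on the finite probability space with point masses `p`. -/
noncomputable def prob {Ω : Type*} [Fintype Ω] (p : Ω → ℝ) (E : Ω → Prop) : ℝ :=
  open Classical in ∑ ω ∈ Finset.univ.filter E, p ω

/-- A distributed algorithm for the dealer and `n` participants. The dealer holds a random secret,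
every node has independent private randomness, and communication proceeds in rounds. In each
round node `u` sends to node `v` a message, or nothing (`none`), as a function `send u v` of all
that `u` knows: the secret if `u` is the dealer, its private randomness, and everything it has
received in the earlier rounds. -/
structure Protocol (n : ℕ) where
  Secret : Type
  [secretFintype : Fintype Secret]
  secretLaw : PMF Secret
  Rand : Option (Fin n) → Type
  [randFintype : ∀ v, Fintype (Rand v)]
  randLaw : ∀ v, PMF (Rand v)
  Msg : Type
  rounds : ℕ
  send : ∀ u _v : Option (Fin n), Option Secret → Rand u →
    List (Option (Fin n) → Option Msg) → Option Msg

attribute [instance] Protocol.secretFintype Protocol.randFintype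

namespace Protocol

variable {n : ℕ} (P : Protocol n)

/-- The outcomes: a value of the secret and of the private randomness of every node. -/
abbrev Outcome := P.Secret × (∀ v, P.Rand v)

/-- The probability of an outcome; the secret and the private random values are independent. -/
noncomputable def weight (ω : P.Outcome) : ℝ :=
  (P.secretLaw ω.1).toReal * ∏ v, (P.randLaw v (ω.2 v)).toReal

/-- Only the dealer has the secret as an input. -/
def input (ω : P.Outcome) : Option (Fin n) → Option P.Secret
  | none => some ω.1
  | some _ => none

/-- What node `v` has received in the first `t` rounds: for each round, the message (or silence)
from every node. Messages travel over the edges of `G` only. -/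
noncomputable def inbox (G : Network n) (ω : P.Outcome) :
    ℕ → Option (Fin n) → List (Option (Fin n) → Option P.Msg)
  | 0, _ => []
  | t + 1, v => inbox G ω t v ++ [fun u =>
      open Classical in
      if G.Adj u v then P.send u v (P.input ω u) (ω.2 u) (inbox G ω t u) else none]

/-- Everything that participant `i` knows at the end. -/
noncomputable def view (G : Network n) (ω : P.Outcome) (i : Fin n) :
    P.Rand (some i) × List (Option (Fin n) → Option P.Msg) :=
  (ω.2 (some i), P.inbox G ω P.rounds (some i))

/-- All the data passed by node `u` to node `v`. -/
noncomputable def transcript (G : Network n) (u v : Option (Fin n)) (ω : P.Outcome) :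
    List (Option P.Msg) :=
  (P.inbox G ω P.rounds v).map fun f => f u

/-- The entropy of the secret, that is, the size of one unit of data. -/
noncomputable def secretEntropy : ℝ := entropy P.weight (fun ω : P.Outcome => ω.1)

/-- The algorithm performs `(n, k)` secret sharing on `G`: the secret is not deterministic, any
`k` participants can together recover it, and the data of fewer than `k` participants is
independent of it. -/
structure IsSecretSharing (G : Network n) (k : ℕ) : Prop where
  nontrivial : 0 < P.secretEntropy
  recovery : ∀ I : Finset (Fin n), I.card = k →
    ∃ dec : (∀ i : I, P.Rand (some i.1) × List (Option (Fin n) → Option P.Msg)) → P.Secret,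
      ∀ ω, P.weight ω ≠ 0 → dec (fun i => P.view G ω i.1) = ω.1
  secrecy : ∀ J : Finset (Fin n), J.card < k → ∀ (s : P.Secret)
    (w : ∀ i : J, P.Rand (some i.1) × List (Option (Fin n) → Option P.Msg)),
      prob P.weight (fun ω => ω.1 = s ∧ (fun i : J => P.view G ω i.1) = w) =
        prob P.weight (fun ω => ω.1 = s) *
          prob P.weight (fun ω => (fun i : J => P.view G ω i.1) = w)

/-- Communication complexity: the sum over all links of the entropy of the data passed over the
link, in units of the size of the secret. (A pair of nodes that is not an edge contributes `0`.) -/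
noncomputable def comm (G : Network n) : ℝ :=
  (∑ u, ∑ v, entropy P.weight (P.transcript G u v)) / P.secretEntropy

end Protocol

/-! ## Separate secure transmissions over node-disjoint paths -/

/-- The data of an instance of the scheme: a finite field, distinct nonzero evaluation points, a
secret of `len` field symbols, and the values of the random symbols drawn by the dealer.
Symbols have positions `0, …, len - 1`; other positions are not used. The length `len` is such
that a share can be cut into any number `b ≤ n` of equal parts. -/
structure SotaSetup (n k : ℕ) where
  F : Type
  [field : Field F]
  [fintype : Fintype F]
  point : ℕ → F
  point_injOn : Set.InjOn point (Set.Iio n)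
  point_ne_zero : ∀ i < n, point i ≠ 0
  len : ℕ
  len_pos : 0 < len
  dvd_len : ∀ b, 1 ≤ b → b ≤ n → b ∣ len
  secret : ℕ → F
  shareRand : Fin (k - 1) → ℕ → F
  chunkRand : Fin n → Fin (k - 1) → ℕ → F

attribute [instance] SotaSetup.field SotaSetup.fintype

/-- A choice of `w ≥ k` node-disjoint paths from the dealer to participant `i`; `mid a` lists the
intermediate nodes of the `a`-th path. -/
structure Routes {n : ℕ} (G : Network n) (k : ℕ) (i : Fin n) where
  w : ℕ
  le_w : k ≤ w
  mid : Fin w → List (Fin n)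
  isPath : ∀ a, List.IsChain G.Adj (none :: (mid a ++ [i]).map some)
  nodup : ∀ a, (mid a ++ [i]).Nodup
  disjoint : ∀ a b, a ≠ b → List.Disjoint (mid a) (mid b)

/-- The nodes of the `a`-th path, from the dealer to participant `i`. -/
def Routes.nodes {n : ℕ} {G : Network n} {k : ℕ} {i : Fin n} (r : Routes G k i) (a : Fin r.w) :
    List (Option (Fin n)) :=
  none :: (r.mid a ++ [i]).map some

namespace SotaSetup

variable {n k : ℕ} (S : SotaSetup n k)

/-- Shamir share of participant `i`, symbol by symbol. -/
def share (i : Fin n) (p : ℕ) : S.F :=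
  S.secret p + ∑ e : Fin (k - 1), S.point i ^ ((e : ℕ) + 1) * S.shareRand e p

/-- The `a`-th of the `w` chunks into which the share of participant `i` is encoded by
two-threshold secret sharing: all `w` chunks determine the share, any `k - 1` of them reveal
nothing about it. The share is cut into `w - k + 1` parts of `len / (w - k + 1)` symbols, which
together with `k - 1` random parts are the coefficients of polynomials of degree less than `w`;
the chunk consists of their values at the `a`-th point. -/
def chunk (i : Fin n) (w a : ℕ) : List S.F :=
  List.ofFn fun p : Fin (S.len / (w - k + 1)) =>
    (∑ c : Fin (w - k + 1), S.point a ^ (c : ℕ) * S.share i (c * (S.len / (w - k + 1)) + p)) +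
      ∑ e : Fin (k - 1), S.point a ^ (w - k + 1 + (e : ℕ)) * S.chunkRand i e p

/-- The transmission of the share of a participant that is connected to the dealer. -/
def directMessages (i : Fin n) : List (Message n S.F) :=
  [Message.mk none (some i) (List.ofFn fun p : Fin S.len => S.share i p)]

/-- The transmissions of the share of participant `i` over the chosen paths: the `a`-th chunk is
passed along every hop of the `a`-th path. -/
def routedMessages {G : Network n} {i : Fin n} (r : Routes G k i) : List (Message n S.F) :=
  (List.finRange r.w).flatMap fun a =>
    ((r.nodes a).zip (r.nodes a).tail).map fun uv => Message.mk uv.1 uv.2 (S.chunk i r.w a)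

/-- Communication complexity of the scheme on `G`, in units of the size of the secret: for each
participant in turn, the paths are chosen so as to minimize the communication. It is `∞` if
some participant outside the neighbourhood of the dealer has no `k` node-disjoint paths. -/
noncomputable def comm (G : Network n) : ℝ≥0∞ :=
  ∑ i : Fin n,
    open Classical in
    if Direct G i then (symbols (S.directMessages i) : ℝ≥0∞) / (S.len : ℝ≥0∞)
    else ⨅ r : Routes G k i, (symbols (S.routedMessages r) : ℝ≥0∞) / (S.len : ℝ≥0∞)

end SotaSetup

end SecretSharing

/-!
**SNEAK.** No participant ever receives more than `d` symbols. As long as some have received fewer,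
the first of them in the order of the propagating-dealer condition has a pending transmission from
the dealer or from a predecessor. Hence a complete run delivers exactly `d` symbols to each.

**Arbitrary algorithms.** Fix a participant `i` and `k - 1` others. If two outcomes agree on the
data passed over the links at `i` and on the views of the others, then the randomness of `i` from
the first outcome can be spliced into the second one without changing any transmission. Afterwards
the `k` views are those of the first outcome, and the secret is that of the second one, so the
secrets agree. As the views of the `k - 1` others are independent of the secret, the data at `i` has
at least the entropy of the secret. Summing over `i` counts every link at most twice.

**Disjoint paths.** The chunks of a share that is not sent directly amount to at least one unit
per hop, so a participant costs at least its distance from the dealer. If the outgoing degrees are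
subpolynomial, then only few participants lie within any fixed distance. In a sliding network the
distance of participant `i` grows like `i / d`, while the residue classes modulo `d` provide `d`
node-disjoint paths.
-/

namespace SecretSharing

/-! ## Entropy on a finite probability space -/

section Entropy

variable {Ω α β γ : Type*} [Fintype Ω] {p : Ω → ℝ}

lemma prob_nonneg (hp : ∀ ω, 0 ≤ p ω) (E : Ω → Prop) : 0 ≤ prob p E :=
  Finset.sum_nonneg fun ω _ => hp ω

lemma prob_le_prob (hp : ∀ ω, 0 ≤ p ω) {E F : Ω → Prop} (h : ∀ ω, p ω ≠ 0 → E ω → F ω) :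
    prob p E ≤ prob p F := by
  classical
  simp only [prob, Finset.sum_filter]
  refine Finset.sum_le_sum fun ω _ => ?_
  rcases eq_or_ne (p ω) 0 with h0 | h0
  · simp [h0]
  · have := h ω h0
    split_ifs <;> simp_all

lemma prob_fiber_pos (hp : ∀ ω, 0 ≤ p ω) (X : Ω → α) {ω : Ω} (hω : p ω ≠ 0) :
    0 < prob p (X · = X ω) := by
  classical
  exact ((hp ω).lt_of_ne' hω).trans_le <|
    Finset.single_le_sum (fun ω' _ => hp ω') (Finset.mem_filter.2 ⟨Finset.mem_univ ω, rfl⟩)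

lemma sum_image_prob_mul [DecidableEq α] (p : Ω → ℝ) (X : Ω → α) (f : α → ℝ) :
    ∑ x ∈ Finset.univ.image X, prob p (X · = x) * f x = ∑ ω, p ω * f (X ω) := by
  rw [← Finset.sum_fiberwise_of_maps_to fun ω _ => Finset.mem_image_of_mem X (Finset.mem_univ ω)]
  refine Finset.sum_congr rfl fun x _ => ?_
  rw [prob, Finset.sum_mul]
  exact Finset.sum_congr (by congr) fun ω hω => by rw [(Finset.mem_filter.1 hω).2]

lemma sum_image_prob [DecidableEq α] (p : Ω → ℝ) (X : Ω → α) :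
    ∑ x ∈ Finset.univ.image X, prob p (X · = x) = ∑ ω, p ω := by
  simpa using sum_image_prob_mul p X fun _ => 1

lemma entropy_eq_sum_mul_neg_log (p : Ω → ℝ) (X : Ω → α) :
    entropy p X = ∑ ω, p ω * -Real.log (prob p (X · = X ω)) := by
  classical
  rw [← sum_image_prob_mul p X fun x => -Real.log (prob p (X · = x)), entropy]
  refine Finset.sum_congr (by congr) fun x _ => ?_
  rw [Real.negMulLog, neg_mul_comm, prob]

lemma entropy_le_of_determines (hp : ∀ ω, 0 ≤ p ω) {X : Ω → α} {Y : Ω → β}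
    (h : ∀ ω ω', p ω ≠ 0 → p ω' ≠ 0 → X ω = X ω' → Y ω = Y ω') :
    entropy p Y ≤ entropy p X := by
  rw [entropy_eq_sum_mul_neg_log, entropy_eq_sum_mul_neg_log]
  refine Finset.sum_le_sum fun ω _ => ?_
  rcases eq_or_ne (p ω) 0 with hω | hω
  · simp [hω]
  · have hfiber : prob p (X · = X ω) ≤ prob p (Y · = Y ω) :=
      prob_le_prob hp fun ω' hω' => h ω' ω hω' hω
    have hlog := Real.log_le_log (prob_fiber_pos hp X hω) hfiber
    exact mul_le_mul_of_nonneg_left (neg_le_neg hlog) (hp ω)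

lemma entropy_const (hp : ∑ ω, p ω = 1) (x : α) : entropy p (fun _ => x) = 0 := by
  simp [entropy_eq_sum_mul_neg_log, prob, hp]

lemma entropy_nonneg (hp : p ∈ stdSimplex ℝ Ω) (X : Ω → α) : 0 ≤ entropy p X :=
  (entropy_const hp.2 ()).ge.trans (entropy_le_of_determines hp.1 fun _ _ _ _ _ => rfl)

lemma sum_mul_log_nonpos (hp : p ∈ stdSimplex ℝ Ω) {r : Ω → ℝ} (hr : ∀ ω, p ω ≠ 0 → 0 < r ω)
    (hsum : ∑ ω, p ω * r ω ≤ 1) : ∑ ω, p ω * Real.log (r ω) ≤ 0 := by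
  calc ∑ ω, p ω * Real.log (r ω)
      ≤ ∑ ω, (p ω * r ω - p ω) := by
        refine Finset.sum_le_sum fun ω _ => ?_
        rcases eq_or_ne (p ω) 0 with hω | hω
        · simp [hω]
        · have := mul_le_mul_of_nonneg_left (Real.log_le_sub_one_of_pos (hr ω hω)) (hp.1 ω)
          linarith
    _ ≤ 0 := by rw [Finset.sum_sub_distrib, hp.2]; linarith

lemma sum_mul_div_prob_le [DecidableEq γ] (p : Ω → ℝ) (Z : Ω → γ) {g : γ → ℝ}
    (hg : ∀ z, 0 ≤ g z) :
    ∑ ω, p ω * (g (Z ω) / prob p (Z · = Z ω)) ≤ ∑ z ∈ Finset.univ.image Z, g z := by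
  rw [← sum_image_prob_mul p Z fun z => g z / prob p (Z · = z)]
  refine Finset.sum_le_sum fun z _ => ?_
  rcases eq_or_ne (prob p (Z · = z)) 0 with h0 | h0
  · simpa [h0] using hg z
  · rw [mul_div_cancel₀ _ h0]

lemma sum_mul_prob_mul_prob_div_prob_le_one (hp : p ∈ stdSimplex ℝ Ω) (X : Ω → α) (Y : Ω → β) :
    ∑ ω, p ω * (prob p (X · = X ω) * prob p (Y · = Y ω) /
      prob p (fun ω' => (X ω', Y ω') = (X ω, Y ω))) ≤ 1 := by
  classical
  have hnonneg : ∀ z : α × β, 0 ≤ prob p (X · = z.1) * prob p (Y · = z.2) := fun z =>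
    mul_nonneg (prob_nonneg hp.1 _) (prob_nonneg hp.1 _)
  have hsub : Finset.univ.image (fun ω => (X ω, Y ω)) ⊆
      Finset.univ.image X ×ˢ Finset.univ.image Y := by
    simp [Finset.image_subset_iff]
  calc ∑ ω, p ω * (prob p (X · = X ω) * prob p (Y · = Y ω) /
        prob p (fun ω' => (X ω', Y ω') = (X ω, Y ω)))
      ≤ ∑ z ∈ Finset.univ.image fun ω => (X ω, Y ω), prob p (X · = z.1) * prob p (Y · = z.2) :=
        sum_mul_div_prob_le p (fun ω => (X ω, Y ω)) hnonneg
    _ ≤ ∑ z ∈ Finset.univ.image X ×ˢ Finset.univ.image Y,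
          prob p (X · = z.1) * prob p (Y · = z.2) :=
        Finset.sum_le_sum_of_subset_of_nonneg hsub fun z _ _ => hnonneg z
    _ = 1 := by
        simp only [Finset.sum_product, ← Finset.sum_mul_sum, sum_image_prob, hp.2, one_mul]

lemma entropy_prodMk_le (hp : p ∈ stdSimplex ℝ Ω) (X : Ω → α) (Y : Ω → β) :
    entropy p (fun ω => (X ω, Y ω)) ≤ entropy p X + entropy p Y := by
  have hpos := fun ω (hω : p ω ≠ 0) => mul_pos (prob_fiber_pos hp.1 X hω) (prob_fiber_pos hp.1 Y hω)
  have hposZ := fun ω (hω : p ω ≠ 0) => prob_fiber_pos hp.1 (fun ω => (X ω, Y ω)) hω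
  have hgibbs := sum_mul_log_nonpos hp (fun ω hω => div_pos (hpos ω hω) (hposZ ω hω))
    (sum_mul_prob_mul_prob_div_prob_le_one hp X Y)
  rw [← sub_nonpos]
  refine le_of_eq_of_le ?_ hgibbs
  simp only [entropy_eq_sum_mul_neg_log, ← Finset.sum_add_distrib, ← Finset.sum_sub_distrib]
  refine Finset.sum_congr rfl fun ω _ => ?_
  rcases eq_or_ne (p ω) 0 with hω | hω
  · simp [hω]
  · rw [Real.log_div (hpos ω hω).ne' (hposZ ω hω).ne', Real.log_mul
      (prob_fiber_pos hp.1 X hω).ne' (prob_fiber_pos hp.1 Y hω).ne']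
    ring

lemma entropy_prodMk_eq_add_of_indep (hp : ∀ ω, 0 ≤ p ω) {X : Ω → α} {Y : Ω → β}
    (h : ∀ x y, prob p (fun ω => X ω = x ∧ Y ω = y) = prob p (X · = x) * prob p (Y · = y)) :
    entropy p (fun ω => (X ω, Y ω)) = entropy p X + entropy p Y := by
  simp only [entropy_eq_sum_mul_neg_log, ← Finset.sum_add_distrib, Prod.mk.injEq, h]
  refine Finset.sum_congr rfl fun ω _ => ?_
  rcases eq_or_ne (p ω) 0 with hω | hω
  · simp [hω]
  · rw [Real.log_mul (prob_fiber_pos hp X hω).ne' (prob_fiber_pos hp Y hω).ne']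
    ring

lemma entropy_restrict_le {ι : Type*} {δ : ι → Type*} (hp : p ∈ stdSimplex ℝ Ω)
    (X : ∀ i, Ω → δ i) (s : Finset ι) :
    entropy p (fun ω (i : s) => X i ω) ≤ ∑ i ∈ s, entropy p (X i) := by
  classical
  induction s using Finset.induction_on with
  | empty =>
    rw [Finset.sum_empty, ← entropy_const hp.2 ()]
    exact entropy_le_of_determines hp.1 fun _ _ _ _ _ =>
      funext fun i => absurd i.2 (Finset.notMem_empty _)
  | insert a s ha ih =>
    rw [Finset.sum_insert ha]
    calc entropy p (fun ω (i : ↥(insert a s)) => X i ω)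
        ≤ entropy p (fun ω => (X a ω, fun i : s => X i ω)) := by
          refine entropy_le_of_determines hp.1 fun ω ω' _ _ h => ?_
          obtain ⟨hhead, htail⟩ := Prod.mk.inj h
          funext ⟨i, hi⟩
          rcases Finset.mem_insert.1 hi with rfl | his
          · exact hhead
          · exact congrFun htail ⟨i, his⟩
      _ ≤ entropy p (X a) + entropy p (fun ω (i : s) => X i ω) := entropy_prodMk_le hp _ _
      _ ≤ entropy p (X a) + ∑ i ∈ s, entropy p (X i) := by gcongr

lemma entropy_pi_le {ι : Type*} [Fintype ι] {δ : ι → Type*} (hp : p ∈ stdSimplex ℝ Ω)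
    (X : ∀ i, Ω → δ i) : entropy p (fun ω i => X i ω) ≤ ∑ i, entropy p (X i) :=
  (entropy_le_of_determines hp.1 fun _ _ _ _ h => funext fun i =>
    congrFun h ⟨i, Finset.mem_univ i⟩).trans (entropy_restrict_le hp X Finset.univ)

lemma entropy_le_of_indep_of_determines (hp : p ∈ stdSimplex ℝ Ω) {X : Ω → α} {Y : Ω → β}
    {Z : Ω → γ}
    (hindep : ∀ x y, prob p (fun ω => X ω = x ∧ Y ω = y) = prob p (X · = x) * prob p (Y · = y))
    (hdet : ∀ ω ω', p ω ≠ 0 → p ω' ≠ 0 → Y ω = Y ω' → Z ω = Z ω' → X ω = X ω') :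
    entropy p X ≤ entropy p Z := by
  have hle : entropy p X + entropy p Y ≤ entropy p Y + entropy p Z :=
    calc entropy p X + entropy p Y = entropy p (fun ω => (X ω, Y ω)) :=
          (entropy_prodMk_eq_add_of_indep hp.1 hindep).symm
      _ ≤ entropy p (fun ω => (Y ω, Z ω)) := by
          refine entropy_le_of_determines hp.1 fun ω ω' hω hω' h => ?_
          obtain ⟨hY, hZ⟩ := Prod.mk.inj h
          exact Prod.ext (hdet ω ω' hω hω' hY hZ) hY
      _ ≤ entropy p Y + entropy p Z := entropy_prodMk_le hp Y Z
  linarith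

end Entropy

/-! ## A lower bound for arbitrary secret sharing algorithms -/

lemma sum_pmf_toReal {α : Type*} [Fintype α] (q : PMF α) : ∑ a, (q a).toReal = 1 := by
  rw [← ENNReal.toReal_sum fun a _ => q.apply_ne_top a, ← tsum_fintype (L := .unconditional _),
    q.tsum_coe, ENNReal.toReal_one]

namespace Protocol

variable {n : ℕ} (P : Protocol n) {G : Network n} {k : ℕ} {ω ω' : P.Outcome} {i : Fin n}

lemma sum_weight : ∑ ω, P.weight ω = 1 := by
  have hrand : ∑ r : (∀ v, P.Rand v), ∏ v, (P.randLaw v (r v)).toReal = 1 := by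
    rw [← Fintype.piFinset_univ,
      ← Finset.prod_univ_sum (fun _ => Finset.univ) fun v x => (P.randLaw v x).toReal]
    simp only [sum_pmf_toReal, Finset.prod_const_one]
  simp only [weight, Fintype.sum_prod_type, ← Finset.mul_sum, hrand, mul_one, sum_pmf_toReal]

lemma weight_mem_stdSimplex : P.weight ∈ stdSimplex ℝ P.Outcome :=
  ⟨fun _ => mul_nonneg ENNReal.toReal_nonneg
    (Finset.prod_nonneg fun _ _ => ENNReal.toReal_nonneg), P.sum_weight⟩

lemma weight_ne_zero_iff :
    P.weight ω ≠ 0 ↔ P.secretLaw ω.1 ≠ 0 ∧ ∀ v, P.randLaw v (ω.2 v) ≠ 0 := by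
  simp [weight, Finset.prod_eq_zero_iff, ENNReal.toReal_eq_zero_iff, PMF.apply_ne_top,
    Option.forall]

/-- What node `v` receives from node `u` in round `t`. -/
noncomputable def arrival (G : Network n) (ω : P.Outcome) (t : ℕ) (u v : Option (Fin n)) :
    Option P.Msg :=
  open Classical in
  if G.Adj u v then P.send u v (P.input ω u) (ω.2 u) (P.inbox G ω t u) else none

lemma inbox_succ (G : Network n) (ω : P.Outcome) (t : ℕ) (v : Option (Fin n)) :
    P.inbox G ω (t + 1) v = P.inbox G ω t v ++ [fun u => P.arrival G ω t u v] := rfl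

lemma inbox_eq_map_arrival (G : Network n) (ω : P.Outcome) (t : ℕ) (v : Option (Fin n)) :
    P.inbox G ω t v = (List.range t).map fun s u => P.arrival G ω s u v := by
  induction t with
  | zero => rfl
  | succ t ih => rw [inbox_succ, ih, List.range_succ, List.map_append, List.map_singleton]

lemma transcript_eq_iff {u v : Option (Fin n)} :
    P.transcript G u v ω = P.transcript G u v ω' ↔
      ∀ t < P.rounds, P.arrival G ω t u v = P.arrival G ω' t u v := by
  simp only [transcript, inbox_eq_map_arrival, List.map_map, List.map_inj_left, List.mem_range,
    Function.comp_apply]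

/-- All the data passed over the links of node `v`: the incoming links are indexed by `Sum.inl`,
the outgoing ones by `Sum.inr`. -/
noncomputable def linkData (G : Network n) (v : Option (Fin n)) (ω : P.Outcome) :
    Option (Fin n) ⊕ Option (Fin n) → List (Option P.Msg) :=
  Sum.elim (fun u => P.transcript G u v ω) (fun u => P.transcript G v u ω)

lemma inbox_eq_of_linkData_eq {v : Option (Fin n)} (h : P.linkData G v ω = P.linkData G v ω')
    {t : ℕ} (ht : t ≤ P.rounds) : P.inbox G ω t v = P.inbox G ω' t v := by
  simp only [inbox_eq_map_arrival, List.map_inj_left, List.mem_range]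
  exact fun s hs => funext fun u =>
    (P.transcript_eq_iff).1 (congrFun h (Sum.inl u)) s (hs.trans_le ht)

/-- The outcome `ω`, with the private randomness of participant `i` taken from `ω'`. -/
def splice (ω ω' : P.Outcome) (i : Fin n) : P.Outcome :=
  (ω.1, Function.update ω.2 (some i) (ω'.2 (some i)))

lemma splice_snd_self : (P.splice ω ω' i).2 (some i) = ω'.2 (some i) :=
  Function.update_self ..

lemma splice_snd_of_ne {v : Option (Fin n)} (hv : v ≠ some i) :
    (P.splice ω ω' i).2 v = ω.2 v :=
  Function.update_of_ne hv ..

lemma input_splice (v : Option (Fin n)) : P.input (P.splice ω ω' i) v = P.input ω v := by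
  cases v <;> rfl

lemma weight_splice_ne_zero (hω : P.weight ω ≠ 0) (hω' : P.weight ω' ≠ 0) :
    P.weight (P.splice ω ω' i) ≠ 0 := by
  rw [weight_ne_zero_iff] at *
  refine ⟨hω.1, fun v => ?_⟩
  rcases eq_or_ne v (some i) with rfl | hv
  · rw [splice_snd_self]
    exact hω'.2 _
  · rw [P.splice_snd_of_ne hv]
    exact hω.2 v

/- By induction on the rounds: the other nodes behave as in `ω`, and participant `i`, whose
incoming data and randomness are those of `ω'`, sends what it sends in `ω'`, which is what it
sends in `ω`. -/
lemma inbox_splice (h : P.linkData G (some i) ω = P.linkData G (some i) ω') {t : ℕ}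
    (ht : t ≤ P.rounds) (v : Option (Fin n)) :
    P.inbox G (P.splice ω ω' i) t v = P.inbox G ω t v := by
  induction t generalizing v with
  | zero => rfl
  | succ t ih =>
    have ih := fun v => ih (by omega) v
    have harrival : ∀ u, P.arrival G (P.splice ω ω' i) t u v = P.arrival G ω t u v := by
      intro u
      rcases eq_or_ne u (some i) with rfl | hu
      · rw [(P.transcript_eq_iff).1 (congrFun h (Sum.inr v)) t ht]
        simp only [arrival, ih, input_splice, splice_snd_self,
          P.inbox_eq_of_linkData_eq h (Nat.le_of_lt ht)]
        rfl
      · simp only [arrival, ih, input_splice, P.splice_snd_of_ne hu]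
    simp only [inbox_succ, ih, harrival]

lemma view_splice_self (h : P.linkData G (some i) ω = P.linkData G (some i) ω') :
    P.view G (P.splice ω ω' i) i = P.view G ω' i := by
  rw [view, view, P.inbox_splice h le_rfl, P.inbox_eq_of_linkData_eq h le_rfl, splice_snd_self]

lemma view_splice_of_ne (h : P.linkData G (some i) ω = P.linkData G (some i) ω') {j : Fin n}
    (hj : j ≠ i) : P.view G (P.splice ω ω' i) j = P.view G ω j := by
  rw [view, view, P.inbox_splice h le_rfl,
    P.splice_snd_of_ne (fun hji => hj (Option.some_injective _ hji))]

lemma secret_eq_of_linkData_eq (hP : P.IsSecretSharing G k) {J : Finset (Fin n)} (hi : i ∉ J)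
    (hJ : J.card + 1 = k) (hω : P.weight ω ≠ 0) (hω' : P.weight ω' ≠ 0)
    (hview : (fun j : J => P.view G ω j.1) = fun j : J => P.view G ω' j.1)
    (hlink : P.linkData G (some i) ω = P.linkData G (some i) ω') : ω.1 = ω'.1 := by
  obtain ⟨dec, hdec⟩ := hP.recovery (insert i J) (by rw [Finset.card_insert_of_notMem hi, hJ])
  have hviews : (fun j : ↥(insert i J) => P.view G (P.splice ω ω' i) j.1) =
      fun j : ↥(insert i J) => P.view G ω' j.1 := by
    funext ⟨j, hj⟩
    rcases eq_or_ne j i with rfl | hji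
    · exact P.view_splice_self hlink
    · rw [P.view_splice_of_ne hlink hji]
      exact congrFun hview ⟨j, Finset.mem_of_mem_insert_of_ne hj hji⟩
  calc ω.1 = (P.splice ω ω' i).1 := rfl
    _ = dec fun j => P.view G (P.splice ω ω' i) j.1 :=
        (hdec _ (P.weight_splice_ne_zero hω hω')).symm
    _ = dec fun j => P.view G ω' j.1 := congrArg dec hviews
    _ = ω'.1 := hdec ω' hω'

lemma secretEntropy_le_entropy_linkData (hk : 1 ≤ k) (hn : k ≤ n) (hP : P.IsSecretSharing G k)
    (i : Fin n) : P.secretEntropy ≤ entropy P.weight (P.linkData G (some i)) := by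
  obtain ⟨J, hJi, hJ⟩ := Finset.exists_subset_card_eq (s := Finset.univ.erase i) (n := k - 1)
    (by rw [Finset.card_erase_of_mem (Finset.mem_univ i), Finset.card_fin]; omega)
  have hi : i ∉ J := fun h => Finset.notMem_erase i _ (hJi h)
  exact entropy_le_of_indep_of_determines P.weight_mem_stdSimplex (hP.secrecy J (by omega))
    fun ω ω' hω hω' => P.secret_eq_of_linkData_eq hP hi (by omega) hω hω'

lemma entropy_linkData_le (G : Network n) (v : Option (Fin n)) :
    entropy P.weight (P.linkData G v) ≤
      ∑ u, entropy P.weight (P.transcript G u v) + ∑ u, entropy P.weight (P.transcript G v u) :=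
  (entropy_pi_le P.weight_mem_stdSimplex fun a ω => P.linkData G v ω a).trans_eq
    (Fintype.sum_sum_type _)

theorem le_two_mul_comm (hk : 1 ≤ k) (hn : k ≤ n) (hP : P.IsSecretSharing G k) :
    (n : ℝ) ≤ 2 * P.comm G := by
  have hnonneg : 0 ≤ entropy P.weight (P.linkData G none) :=
    entropy_nonneg P.weight_mem_stdSimplex _
  rw [comm, ← mul_div_assoc, le_div_iff₀ hP.nontrivial]
  calc (n : ℝ) * P.secretEntropy = ∑ _i : Fin n, P.secretEntropy := by simp
    _ ≤ ∑ i : Fin n, entropy P.weight (P.linkData G (some i)) :=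
        Finset.sum_le_sum fun i _ => P.secretEntropy_le_entropy_linkData hk hn hP i
    _ ≤ ∑ v, entropy P.weight (P.linkData G v) := by
        rw [Fintype.sum_option]
        linarith
    _ ≤ ∑ v, (∑ u, entropy P.weight (P.transcript G u v) +
          ∑ u, entropy P.weight (P.transcript G v u)) :=
        Finset.sum_le_sum fun v _ => P.entropy_linkData_le G v
    _ = 2 * ∑ u, ∑ v, entropy P.weight (P.transcript G u v) := by
        rw [Finset.sum_add_distrib, Finset.sum_comm, two_mul]

end Protocol

/-! ## Communication of SNEAK -/

lemma exists_reflTransGen_forall_not {α : Type*} {r : α → α → Prop} {a : α} (f : α → ℕ) {b : ℕ}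
    (hf : ∀ x y, r x y → f x < f y) (hb : ∀ x, Relation.ReflTransGen r a x → f x ≤ b) :
    ∃ x, Relation.ReflTransGen r a x ∧ ∀ y, ¬ r x y := by
  have hbdd : BddAbove (f '' {x | Relation.ReflTransGen r a x}) :=
    ⟨b, Set.forall_mem_image.2 hb⟩
  obtain ⟨x, hx, hmax⟩ := Nat.sSup_mem ⟨f a, Set.mem_image_of_mem f .refl⟩ hbdd
  exact ⟨x, hx, fun y hxy => (hf x y hxy).not_ge <|
    hmax ▸ le_csSup hbdd (Set.mem_image_of_mem f (hx.tail hxy))⟩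

lemma PropagatingDealer.induction {n m : ℕ} {G : Network n} (hG : PropagatingDealer G m)
    {q : Fin n → Prop} (direct : ∀ i, Direct G i → q i)
    (propagate : ∀ i, ¬ Direct G i → m ≤ {j | q j ∧ G.Adj (some j) (some i)}.ncard → q i)
    (i : Fin n) : q i := by
  obtain ⟨rank, hrank⟩ := hG
  induction i using (measure fun i => (rank i : ℕ)).wf.induction with
  | _ i ih =>
    by_cases hi : Direct G i
    · exact direct i hi
    · exact propagate i hi <| ((hrank i).resolve_left hi).trans <|
        Set.ncard_le_ncard fun j hj => ⟨ih j hj.1, hj.2⟩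

section Log

variable {n d : ℕ} {F : Type} {G : Network n} {log : List (Message n F)} {m : Message n F}

/-- The link over which a message is sent. -/
def Message.link (m : Message n F) : Option (Fin n) × Option (Fin n) := (m.src, m.dst)

/-- The number of field symbols that node `v` has received. -/
def received (log : List (Message n F)) (v : Option (Fin n)) : ℕ :=
  symbols (log.filter fun m => m.dst = v)

/-- The nodes that have sent a message to node `v`. -/
def senders (log : List (Message n F)) (v : Option (Fin n)) : Finset (Option (Fin n)) :=
  ((log.filter fun m => m.dst = v).map Message.src).toFinset

lemma symbols_cons (m : Message n F) (log : List (Message n F)) :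
    symbols (m :: log) = m.payload.length + symbols log := by
  simp only [symbols, List.map_cons, List.sum_cons]

lemma received_nil (v : Option (Fin n)) : received ([] : List (Message n F)) v = 0 := rfl

lemma received_cons (m : Message n F) (log : List (Message n F)) (v : Option (Fin n)) :
    received (m :: log) v = (if m.dst = v then m.payload.length else 0) + received log v := by
  by_cases h : m.dst = v <;> simp [received, h, symbols_cons]

lemma received_eq_zero {v : Option (Fin n)} (h : ∀ m ∈ log, m.dst ≠ v) : received log v = 0 := by
  rw [received, List.filter_eq_nil_iff.2 (by simpa using h)]
  rfl

lemma symbols_eq_sum_received (log : List (Message n F)) :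
    symbols log = ∑ v, received log v := by
  induction log with
  | nil => simp only [received_nil, Finset.sum_const_zero]; rfl
  | cons m log ih => simp only [symbols_cons, received_cons, Finset.sum_add_distrib, ih,
      Finset.sum_ite_eq, Finset.mem_univ, if_true]

lemma length_payload_le_received (hm : m ∈ log) : m.payload.length ≤ received log m.dst :=
  List.le_sum_of_mem <| List.mem_map_of_mem <| List.mem_filter.2 ⟨hm, decide_eq_true rfl⟩

lemma mem_senders {u v : Option (Fin n)} :
    u ∈ senders log v ↔ ∃ m ∈ log, m.dst = v ∧ m.src = u := by
  simp only [senders, List.mem_toFinset, List.mem_map, List.mem_filter, decide_eq_true_eq,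
    and_assoc]

lemma card_senders (h : (log.map Message.link).Nodup) (v : Option (Fin n)) :
    (senders log v).card = log.countP fun m => decide (m.dst = v) := by
  rw [senders, List.toFinset_card_of_nodup, List.length_map, List.countP_eq_length_filter]
  refine (h.of_map.filter _).map_on fun m hm m' hm' hsrc => ?_
  simp only [List.mem_filter, decide_eq_true_eq] at hm hm'
  exact List.inj_on_of_nodup_map h hm.1 hm'.1 (Prod.ext hsrc (hm.2.trans hm'.2.symm))

/-- The messages of SNEAK: a vector of `d` symbols from the dealer to a neighbour, or one symbol
from a participant to a participant that is not connected to the dealer. -/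
inductive IsSneakMessage (G : Network n) (d : ℕ) : Message n F → Prop
  | dealt {j : Fin n} (hj : Direct G j) (v : Fin d → F) :
      IsSneakMessage G d ⟨none, some j, List.ofFn v⟩
  | passed {j : Fin n} (hj : ¬ Direct G j) (i : Fin n) (x : F) :
      IsSneakMessage G d ⟨some i, some j, [x]⟩

/-- The invariant of the executions of SNEAK: every message has one of the two forms, every link
is used at most once, and no node receives more than `d` symbols. -/
structure IsSneakLog (G : Network n) (d : ℕ) (log : List (Message n F)) : Prop where
  isSneakMessage : ∀ m ∈ log, IsSneakMessage G d m
  nodup_link : (log.map Message.link).Nodup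
  received_le : ∀ v, received log v ≤ d

namespace IsSneakLog

lemma nil : IsSneakLog G d ([] : List (Message n F)) :=
  ⟨by simp only [List.not_mem_nil, false_imp_iff, implies_true], List.nodup_nil, fun _ => d.zero_le⟩

lemma cons (h : IsSneakLog G d log) (hm : IsSneakMessage G d m)
    (hfresh : ∀ m' ∈ log, ¬ (m'.src = m.src ∧ m'.dst = m.dst))
    (hle : m.payload.length + received log m.dst ≤ d) : IsSneakLog G d (m :: log) where
  isSneakMessage := List.forall_mem_cons.2 ⟨hm, h.isSneakMessage⟩
  nodup_link := by
    refine List.nodup_cons.2 ⟨fun hmem => ?_, h.nodup_link⟩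
    obtain ⟨m', hm', hlink⟩ := List.mem_map.1 hmem
    exact hfresh m' hm' (Prod.mk.inj hlink)
  received_le v := by
    rw [received_cons]
    split_ifs with hv
    · exact hv ▸ hle
    · exact (zero_add _).trans_le (h.received_le v)

lemma length_le (h : IsSneakLog G d log) : log.length ≤ (n + 1) * (n + 1) := by
  simpa using h.nodup_link.length_le_card

lemma received_none (h : IsSneakLog G d log) : received log none = 0 :=
  received_eq_zero fun m hm => by cases h.isSneakMessage m hm <;> exact Option.some_ne_none _

lemma received_eq_card_senders (h : IsSneakLog G d log) {i : Fin n} (hi : ¬ Direct G i) :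
    received log (some i) = (senders log (some i)).card := by
  have hlength : ∀ m ∈ log.filter fun m => m.dst = some i, m.payload.length = 1 := by
    intro m hm
    obtain ⟨hm, hdst⟩ := List.mem_filter.1 hm
    cases h.isSneakMessage m hm with
    | dealt hj v => exact absurd hj (by simp_all)
    | passed hj j x => rfl
  rw [card_senders h.nodup_link, List.countP_eq_length_filter, received, symbols,
    List.map_congr_left hlength, List.map_const', List.sum_replicate, smul_eq_mul, mul_one]

lemma src_eq_none (h : IsSneakLog G d log) {i : Fin n} (hi : Direct G i) (hm : m ∈ log)
    (hdst : m.dst = some i) : m.src = none := by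
  cases h.isSneakMessage m hm with
  | dealt => rfl
  | passed hj j x => simp_all

lemma exists_passed_of_mem_senders (h : IsSneakLog G d log) {i : Fin n} (hi : ¬ Direct G i)
    {u : Option (Fin n)} (hu : u ∈ senders log (some i)) :
    ∃ j x, u = some j ∧ ⟨some j, some i, [x]⟩ ∈ log := by
  obtain ⟨m, hm, hdst, rfl⟩ := mem_senders.1 hu
  cases h.isSneakMessage m hm with
  | dealt hj v => simp_all
  | passed hj j x =>
    obtain rfl := Option.some_injective _ hdst
    exact ⟨j, x, rfl, hm⟩

end IsSneakLog

end Log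

namespace SneakSetup

variable {n k d : ℕ} {S : SneakSetup n k d} {G : Network n} {log log' : List (Message n S.F)}
  {i : Fin n}

lemma Step.isSneakLog (hstep : S.Step G log log') (h : IsSneakLog G d log) :
    IsSneakLog G d log' := by
  cases hstep with
  | deal j hj hfresh =>
    have hzero : received log (some j) = 0 :=
      received_eq_zero fun m hm hdst => hfresh m hm ⟨h.src_eq_none hj hm hdst, hdst⟩
    exact h.cons (.dealt hj _) hfresh (by rw [hzero, List.length_ofFn, add_zero])
  | pass i j v hij hv hj hneed hfresh =>
    rw [← card_senders h.nodup_link, ← h.received_eq_card_senders hj] at hneed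
    exact h.cons (.passed hj i _) hfresh ((add_comm _ _).trans_le hneed)

lemma isSneakLog_of_reflTransGen (h : Relation.ReflTransGen (S.Step G) [] log) :
    IsSneakLog G d log := by
  induction h with
  | refl => exact .nil
  | tail _ hstep ih => exact hstep.isSneakLog ih

lemma Step.length_lt (hstep : S.Step G log log') : log.length < log'.length := by
  cases hstep <;> exact Nat.lt_succ_self _

variable (S G) in
theorem exists_completeRun : ∃ log, S.CompleteRun G log :=
  exists_reflTransGen_forall_not List.length (fun _ _ => Step.length_lt)
    fun _ h => (isSneakLog_of_reflTransGen h).length_le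

namespace CompleteRun

variable (h : S.CompleteRun G log)
include h

lemma isSneakLog : IsSneakLog G d log := isSneakLog_of_reflTransGen h.1

lemma exists_dealt_mem (hi : Direct G i) :
    ∃ v : Fin d → S.F, ⟨none, some i, List.ofFn v⟩ ∈ log := by
  obtain ⟨m, hm, hsrc, hdst⟩ : ∃ m ∈ log, m.src = none ∧ m.dst = some i := by
    by_contra! hfresh
    exact h.2 _ (.deal log i hi fun m hm hlink => hfresh m hm hlink.1 hlink.2)
  cases h.isSneakLog.isSneakMessage m hm with
  | dealt hj v =>
    obtain rfl := Option.some_injective _ hdst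
    exact ⟨v, hm⟩
  | passed => cases hsrc

lemma le_card_senders (hi : ¬ Direct G i)
    (hpred : d ≤ {j | (∃ v, S.Holds G log j v) ∧ G.Adj (some j) (some i)}.ncard) :
    d ≤ (senders log (some i)).card := by
  by_contra! hlt
  obtain ⟨_, ⟨j, ⟨⟨v, hv⟩, hadj⟩, rfl⟩, hj⟩ : ∃ u ∈ some '' {j | (∃ v, S.Holds G log j v) ∧
      G.Adj (some j) (some i)}, u ∉ (senders log (some i) : Set (Option (Fin n))) := by
    refine Set.exists_mem_notMem_of_ncard_lt_ncard ?_
    rw [Set.ncard_coe_finset, Set.ncard_image_of_injective _ (Option.some_injective _)]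
    exact hlt.trans_le hpred
  refine h.2 _ (.pass log j i v hadj hv hi ?_ fun m hm hlink =>
    hj (mem_senders.2 ⟨m, hm, hlink.2, hlink.1⟩))
  rwa [← card_senders h.isSneakLog.nodup_link]

lemma exists_holds_of_le_card_senders (hi : ¬ Direct G i)
    (hd : d ≤ (senders log (some i)).card) : ∃ v, S.Holds G log i v := by
  obtain ⟨B, hBsub, hB⟩ := Finset.exists_subset_card_eq hd
  let e := B.equivFinOfCardEq hB
  choose nb σ hnb hσ using fun a =>
    h.isSneakLog.exists_passed_of_mem_senders hi (hBsub (e.symm a).2)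
  refine ⟨_, .solved hi nb (fun a b hab => e.symm.injective (Subtype.ext ?_)) σ hσ⟩
  rw [hnb a, hnb b, hab]

lemma exists_holds_and_received_eq (hG : PropagatingDealer G d) (i : Fin n) :
    (∃ v, S.Holds G log i v) ∧ received log (some i) = d := by
  suffices hi : (∃ v, S.Holds G log i v) ∧ d ≤ received log (some i) from
    ⟨hi.1, (h.isSneakLog.received_le _).antisymm hi.2⟩
  refine hG.induction (q := fun i => (∃ v, S.Holds G log i v) ∧ d ≤ received log (some i))
    (fun i hi => ?_) (fun i hi hpred => ?_) i
  · obtain ⟨v, hv⟩ := h.exists_dealt_mem hi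
    exact ⟨⟨v, .dealt v hv⟩, List.length_ofFn.ge.trans (length_payload_le_received hv)⟩
  · have hsenders := h.le_card_senders hi (hpred.trans (Set.ncard_le_ncard fun j hj =>
      ⟨hj.1.1, hj.2⟩))
    exact ⟨h.exists_holds_of_le_card_senders hi hsenders,
      hsenders.trans_eq (h.isSneakLog.received_eq_card_senders hi).symm⟩

lemma symbols_eq (hG : PropagatingDealer G d) : symbols log = n * d := by
  rw [symbols_eq_sum_received, Fintype.sum_option, h.isSneakLog.received_none, zero_add,
    Finset.sum_congr rfl fun i _ => (h.exists_holds_and_received_eq hG i).2, Finset.sum_const,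
    Finset.card_fin, smul_eq_mul]

theorem comm_eq (hG : PropagatingDealer G d) :
    S.comm log = d / ((d - k + 1 : ℕ) : ℝ) * n := by
  rw [comm, h.symbols_eq hG, Nat.cast_mul, mul_comm, mul_div_right_comm]

theorem comm_le_mul_comm (hn : k ≤ n) (hG : PropagatingDealer G d) {P : Protocol n}
    (hP : P.IsSecretSharing G k) :
    S.comm log ≤ 2 * d / ((d - k + 1 : ℕ) : ℝ) * P.comm G :=
  calc S.comm log = d / ((d - k + 1 : ℕ) : ℝ) * n := h.comm_eq hG
    _ ≤ d / ((d - k + 1 : ℕ) : ℝ) * (2 * P.comm G) := by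
        gcongr
        exact P.le_two_mul_comm S.one_le hn hP
    _ = 2 * d / ((d - k + 1 : ℕ) : ℝ) * P.comm G := by ring

end CompleteRun

end SneakSetup

/-! ## Communication over node-disjoint paths -/

lemma apply_le_add_length_of_isChain {V : Type*} {R : V → V → Prop} {f : V → ℕ}
    (hf : ∀ u v, R u v → f v ≤ f u + 1) {l : List V} {u v : V} (hl : List.IsChain R (u :: l))
    (hv : v ∈ l) : f v ≤ f u + l.length := by
  induction l generalizing u with
  | nil => cases hv
  | cons w l ih =>
    obtain ⟨huw, hl⟩ := List.isChain_cons_cons.1 hl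
    have hw := hf u w huw
    rw [List.length_cons]
    obtain rfl | hv := List.mem_cons.1 hv
    · omega
    · have := ih hl hv
      omega

namespace Routes

variable {n k : ℕ} {G : Network n} {i : Fin n} (r : Routes G k i)

lemma apply_le_length_mid_add_one {f : Option (Fin n) → ℕ} (h0 : f none = 0)
    (hadj : ∀ u v, G.Adj u v → f v ≤ f u + 1) (a : Fin r.w) :
    f (some i) ≤ (r.mid a).length + 1 := by
  simpa [h0] using apply_le_add_length_of_isChain hadj (r.isPath a) (v := some i) (by simp)

lemma length_mid_lt (a : Fin r.w) : (r.mid a).length < n := by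
  simpa using (r.nodup a).length_le_card

lemma mid_ne_nil (hi : ¬ Direct G i) (a : Fin r.w) : r.mid a ≠ [] := fun h =>
  hi (by simpa [Direct, h] using r.isPath a)

lemma w_le (hi : ¬ Direct G i) : r.w ≤ n := by
  have hinj : Function.Injective fun a => (r.mid a).head (r.mid_ne_nil hi a) := fun a b hab => by
    by_contra hne
    have hb := List.head_mem (r.mid_ne_nil hi b)
    rw [← show (r.mid a).head _ = (r.mid b).head _ from hab] at hb
    exact r.disjoint a b hne (List.head_mem _) hb
  simpa using Fintype.card_le_of_injective _ hinj

end Routes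

namespace SotaSetup

variable {n k : ℕ} (S : SotaSetup n k) {G : Network n} {i : Fin n}

lemma symbols_directMessages (i : Fin n) : symbols (S.directMessages i) = S.len := by
  simp [symbols, directMessages]

lemma symbols_routedMessages (r : Routes G k i) :
    symbols (S.routedMessages r) = ∑ a, ((r.mid a).length + 1) * (S.len / (r.w - k + 1)) := by
  have hhops (a : Fin r.w) : (((r.nodes a).zip (r.nodes a).tail).map fun uv =>
      (Message.mk uv.1 uv.2 (S.chunk i r.w a)).payload.length).sum =
        ((r.mid a).length + 1) * (S.len / (r.w - k + 1)) := by
    simp [chunk, Routes.nodes]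
  rw [symbols, routedMessages, List.map_flatMap, List.flatMap_def, List.sum_flatten, List.map_map,
    ← List.ofFn_eq_map, List.sum_ofFn]
  simp only [Function.comp_apply, List.map_map, ← hhops]
  rfl

lemma mul_len_le_symbols_routedMessages (hk : 1 ≤ k) (hi : ¬ Direct G i) (r : Routes G k i)
    {L : ℕ} (hL : ∀ a, L ≤ (r.mid a).length + 1) :
    L * S.len ≤ symbols (S.routedMessages r) := by
  have hkw := r.le_w
  have hwn := r.w_le hi
  calc L * S.len = L * ((r.w - k + 1) * (S.len / (r.w - k + 1))) := by
        rw [Nat.mul_div_cancel' (S.dvd_len _ (by omega) (by omega))]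
    _ ≤ L * (r.w * (S.len / (r.w - k + 1))) := by gcongr; omega
    _ = ∑ _a : Fin r.w, L * (S.len / (r.w - k + 1)) := by
        rw [Finset.sum_const, Finset.card_fin, smul_eq_mul, mul_left_comm]
    _ ≤ ∑ a, ((r.mid a).length + 1) * (S.len / (r.w - k + 1)) := by gcongr; exact hL _
    _ = symbols (S.routedMessages r) := (S.symbols_routedMessages r).symm

lemma symbols_routedMessages_le (r : Routes G k i) :
    symbols (S.routedMessages r) ≤ r.w * n * S.len :=
  calc symbols (S.routedMessages r)
      = ∑ a, ((r.mid a).length + 1) * (S.len / (r.w - k + 1)) := S.symbols_routedMessages r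
    _ ≤ ∑ _a : Fin r.w, n * S.len :=
        Finset.sum_le_sum fun a _ => Nat.mul_le_mul (r.length_mid_lt a) (Nat.div_le_self _ _)
    _ = r.w * n * S.len := by rw [Finset.sum_const, Finset.card_fin, smul_eq_mul, mul_assoc]

lemma natCast_le_div_len {L s : ℕ} (h : L * S.len ≤ s) : (L : ℝ≥0∞) ≤ s / S.len := by
  rw [ENNReal.le_div_iff_mul_le (.inl (Nat.cast_ne_zero.2 S.len_pos.ne'))
    (.inl (ENNReal.natCast_ne_top _))]
  exact_mod_cast h

lemma div_len_le_natCast {L s : ℕ} (h : s ≤ L * S.len) : (s : ℝ≥0∞) / S.len ≤ L :=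
  ENNReal.div_le_of_le_mul (by exact_mod_cast h)

theorem sum_le_comm (hk : 1 ≤ k) {f : Option (Fin n) → ℕ} (h0 : f none = 0)
    (hadj : ∀ u v, G.Adj u v → f v ≤ f u + 1) :
    ((∑ i, f (some i) : ℕ) : ℝ≥0∞) ≤ S.comm G := by
  rw [Nat.cast_sum, comm]
  refine Finset.sum_le_sum fun i _ => ?_
  split_ifs with hi
  · refine S.natCast_le_div_len ?_
    rw [symbols_directMessages]
    have hfi : f (some i) ≤ 1 := by simpa [h0] using hadj none (some i) hi
    exact Nat.mul_le_of_le_div _ _ _ (by rwa [Nat.div_self S.len_pos])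
  · exact le_iInf fun r => S.natCast_le_div_len <|
      S.mul_len_le_symbols_routedMessages hk hi r (r.apply_le_length_mid_add_one h0 hadj)

theorem comm_le {L : ℕ} (hL : 1 ≤ L)
    (hroute : ∀ i, ¬ Direct G i → ∃ r : Routes G k i, r.w ≤ L) :
    S.comm G ≤ L * (n : ℝ≥0∞) ^ 2 := by
  have hterm (i : Fin n) (hi : ¬ Direct G i) :
      ⨅ r : Routes G k i, (symbols (S.routedMessages r) : ℝ≥0∞) / S.len ≤ (L * n : ℕ) := by
    obtain ⟨r, hr⟩ := hroute i hi
    refine (iInf_le _ r).trans (S.div_len_le_natCast ((S.symbols_routedMessages_le r).trans ?_))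
    gcongr
  calc S.comm G ≤ ∑ _i : Fin n, ((L * n : ℕ) : ℝ≥0∞) := by
        rw [comm]
        refine Finset.sum_le_sum fun i _ => ?_
        split_ifs with hi
        · refine S.div_len_le_natCast ?_
          rw [symbols_directMessages]
          exact Nat.le_mul_of_pos_left _ (Nat.mul_pos hL (Fin.pos i))
        · exact hterm i hi
    _ = L * (n : ℝ≥0∞) ^ 2 := by
        rw [Finset.sum_const, Finset.card_fin, nsmul_eq_mul, Nat.cast_mul]
        ring

end SotaSetup

/-! ## Networks with small outgoing degrees -/

section DealerBall

variable {n : ℕ} {G : Network n} {t : ℕ}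

open Classical in
/-- The nodes that can be reached from the dealer in at most `t` hops. -/
noncomputable def dealerBall (G : Network n) : ℕ → Finset (Option (Fin n))
  | 0 => {none}
  | t + 1 => dealerBall G t ∪ (dealerBall G t).biUnion fun u => Finset.univ.filter (G.Adj u)

lemma none_mem_dealerBall : none ∈ dealerBall G t := by
  induction t with
  | zero => exact Finset.mem_singleton_self _
  | succ t ih => exact Finset.mem_union_left _ ih

lemma mem_dealerBall_succ {u v : Option (Fin n)} (hu : u ∈ dealerBall G t) (huv : G.Adj u v) :
    v ∈ dealerBall G (t + 1) :=
  Finset.mem_union_right _ (Finset.mem_biUnion.2 ⟨u, hu, by simpa using huv⟩)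

lemma ncard_adj_le_maxOutDegree (G : Network n) (u : Option (Fin n)) :
    {v | G.Adj u v}.ncard ≤ maxOutDegree G :=
  Finset.le_sup (f := fun u => {v | G.Adj u v}.ncard) (Finset.mem_univ u)

open Classical in
lemma card_dealerBall_le (G : Network n) (t : ℕ) :
    (dealerBall G t).card ≤ (1 + maxOutDegree G) ^ t := by
  induction t with
  | zero => simp only [dealerBall, Finset.card_singleton, pow_zero, le_refl]
  | succ t ih =>
    calc (dealerBall G (t + 1)).card
        ≤ (dealerBall G t).card +
            ((dealerBall G t).biUnion fun u => Finset.univ.filter (G.Adj u)).card := by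
          rw [dealerBall]
          exact Finset.card_union_le _ _
      _ ≤ (dealerBall G t).card + (dealerBall G t).card * maxOutDegree G := by
          gcongr
          refine Finset.card_biUnion_le_card_mul _ _ _ fun u _ => ?_
          simpa [← Set.ncard_coe_finset] using ncard_adj_le_maxOutDegree G u
      _ = (dealerBall G t).card * (1 + maxOutDegree G) := by ring
      _ ≤ (1 + maxOutDegree G) ^ (t + 1) := by rw [pow_succ]; gcongr

lemma le_card_notMem_dealerBall_add_pow (G : Network n) (t : ℕ) :
    n ≤ (Finset.univ.filter fun i : Fin n => some i ∉ dealerBall G t).card +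
      (1 + maxOutDegree G) ^ t := by
  have hmem : (Finset.univ.filter fun i : Fin n => some i ∈ dealerBall G t).card ≤
      (dealerBall G t).card :=
    Finset.card_le_card_of_injOn some (fun i hi => (Finset.mem_filter.1 hi).2)
      (Option.some_injective _).injOn
  have hsplit := Finset.card_filter_add_card_filter_not (s := (Finset.univ : Finset (Fin n)))
    fun i => some i ∈ dealerBall G t
  have hball := card_dealerBall_le G t
  rw [Finset.card_fin] at hsplit
  omega

end DealerBall

/-- The distance of `v` from the dealer, capped at `L`: the number of radii `t < L` for which `v`
is outside the ball of radius `t` around the dealer. -/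
noncomputable def cappedDist {n : ℕ} (G : Network n) (L : ℕ) (v : Option (Fin n)) : ℕ :=
  ∑ t ∈ Finset.range L, if v ∉ dealerBall G t then 1 else 0

lemma cappedDist_le_add_one {n : ℕ} {G : Network n} (L : ℕ) {u v : Option (Fin n)}
    (huv : G.Adj u v) : cappedDist G L v ≤ cappedDist G L u + 1 := by
  cases L with
  | zero => exact Nat.zero_le _
  | succ L =>
    rw [cappedDist, Finset.sum_range_succ', cappedDist, Finset.sum_range_succ]
    gcongr ?_ + ?_
    · refine (Finset.sum_le_sum fun t _ => ?_).trans (Nat.le_add_right _ _)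
      have := mt fun hu => mem_dealerBall_succ (t := t) hu huv
      split_ifs <;> simp_all
    · split_ifs <;> simp

lemma mul_sub_pow_le_sum_cappedDist {n : ℕ} (G : Network n) (L : ℕ) :
    L * (n - (1 + maxOutDegree G) ^ L) ≤ ∑ i : Fin n, cappedDist G L (some i) := by
  have hradius (t : ℕ) (ht : t ∈ Finset.range L) : n - (1 + maxOutDegree G) ^ L ≤
      ∑ i : Fin n, if some i ∉ dealerBall G t then 1 else 0 := by
    have hpow : (1 + maxOutDegree G) ^ t ≤ (1 + maxOutDegree G) ^ L :=
      Nat.pow_le_pow_right (Nat.le_add_right _ _) (Finset.mem_range.1 ht).le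
    have := le_card_notMem_dealerBall_add_pow G t
    rw [← Finset.card_filter]
    omega
  calc L * (n - (1 + maxOutDegree G) ^ L)
      = ∑ _t ∈ Finset.range L, (n - (1 + maxOutDegree G) ^ L) := by
        rw [Finset.sum_const, Finset.card_range, smul_eq_mul]
    _ ≤ ∑ t ∈ Finset.range L, ∑ i : Fin n, if some i ∉ dealerBall G t then 1 else 0 :=
        Finset.sum_le_sum hradius
    _ = ∑ i : Fin n, cappedDist G L (some i) := Finset.sum_comm

lemma SotaSetup.mul_le_comm_of_two_mul_pow_le {n k : ℕ} (S : SotaSetup n k) (hk : 1 ≤ k)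
    {G : Network n} {x : ℕ} (h : 2 * (1 + maxOutDegree G) ^ (2 * x) ≤ n) :
    (x : ℝ≥0∞) * n ≤ S.comm G :=
  calc (x : ℝ≥0∞) * n = ((x * n : ℕ) : ℝ≥0∞) := (Nat.cast_mul _ _).symm
    _ ≤ ((x * (2 * (n - (1 + maxOutDegree G) ^ (2 * x))) : ℕ) : ℝ≥0∞) := by
        gcongr
        omega
    _ ≤ ((∑ i, cappedDist G (2 * x) (some i) : ℕ) : ℝ≥0∞) := by
        rw [mul_left_comm, ← mul_assoc]
        exact Nat.cast_le.2 (mul_sub_pow_le_sum_cappedDist G (2 * x))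
    _ ≤ S.comm G := S.sum_le_comm hk (by simp [cappedDist, none_mem_dealerBall])
        fun _ _ => cappedDist_le_add_one _

lemma isLittleO_one_add_pow_of_isBigO_rpow {ι : Type*} {l : Filter ι} {x D : ι → ℝ}
    (hx : Tendsto x l atTop) (hD : ∀ δ : ℝ, 0 < δ → D =O[l] fun i => x i ^ δ) (L : ℕ) :
    (fun i => (1 + D i) ^ L) =o[l] x := by
  have hδ : (0 : ℝ) < 1 / (L + 1) := by positivity
  have hxδ : Tendsto (fun i => x i ^ (1 / (L + 1) : ℝ)) l atTop := (tendsto_rpow_atTop hδ).comp hx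
  have hbig : (fun i => (1 + D i) ^ L) =O[l] fun i => (x i ^ (1 / (L + 1) : ℝ)) ^ L :=
    (((isLittleO_const_left.2 (.inr (tendsto_norm_atTop_atTop.comp hxδ))).isBigO).add
      (hD _ hδ)).pow L
  refine hbig.trans_isLittleO ?_
  have hlittle : (fun y : ℝ => y ^ L) =o[atTop] fun y => y ^ (L + 1) :=
    isLittleO_pow_pow_atTop_of_lt L.lt_succ_self
  refine (hlittle.comp_tendsto hxδ).congr' .rfl ?_
  filter_upwards [hx.eventually_ge_atTop 0] with i hi
  have hL : (1 / (L + 1) : ℝ) = ((L + 1 : ℕ) : ℝ)⁻¹ := by rw [Nat.cast_add_one, one_div]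
  rw [Function.comp_apply, hL, Real.rpow_inv_natCast_pow hi L.succ_ne_zero]

theorem tendsto_comm_div_nhds_top {ι : Type*} {l : Filter ι} {k : ℕ} (hk : 1 ≤ k) {N : ι → ℕ}
    (hN : Tendsto N l atTop) {G : ∀ m, Network (N m)}
    (hG : ∀ δ : ℝ, 0 < δ → (fun m => (maxOutDegree (G m) : ℝ)) =O[l] fun m => (N m : ℝ) ^ δ)
    (S : ∀ m, SotaSetup (N m) k) :
    Tendsto (fun m => (S m).comm (G m) / (N m : ℝ≥0∞)) l (𝓝 ⊤) := by
  rw [ENNReal.tendsto_nhds_top_iff_nat]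
  intro x
  have hpow := (isLittleO_one_add_pow_of_isBigO_rpow (tendsto_natCast_atTop_atTop.comp hN) hG
    (2 * (x + 1))).bound (c := 1 / 2) (by norm_num)
  filter_upwards [hpow, hN.eventually_gt_atTop 0] with m hm hpos
  have hcomm : ((x + 1 : ℕ) : ℝ≥0∞) * N m ≤ (S m).comm (G m) := by
    refine (S m).mul_le_comm_of_two_mul_pow_le hk ?_
    rw [Function.comp_apply, Real.norm_of_nonneg (by positivity),
      Real.norm_of_nonneg (by positivity)] at hm
    have : 2 * (1 + maxOutDegree (G m) : ℝ) ^ (2 * (x + 1)) ≤ N m := by linarith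
    exact_mod_cast this
  refine (Nat.cast_lt.2 x.lt_succ_self).trans_le ?_
  rwa [ENNReal.le_div_iff_mul_le (.inl (Nat.cast_ne_zero.2 hpos.ne'))
    (.inl (ENNReal.natCast_ne_top _))]

/-! ## Sliding networks -/

/-- The network in which the dealer is connected to the first `d` participants and each participant
to the next `d` participants. It has `d` node-disjoint paths to every participant, but the distance
of participant `i` from the dealer is about `i / d`. -/
def slidingNetwork (d n : ℕ) : Network n where
  Adj
    | none, some j => (j : ℕ) < d
    | some i, some j => i < j ∧ (j : ℕ) ≤ i + d
    | _, none => False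

theorem propagatingDealer_slidingNetwork (d n : ℕ) : PropagatingDealer (slidingNetwork d n) d := by
  refine ⟨Equiv.refl _, fun i => or_iff_not_imp_left.2 fun hi => ?_⟩
  have hdi : d ≤ i := not_lt.1 hi
  let pred : Fin d → Fin n := fun a => ⟨i - 1 - a, by omega⟩
  have hpred : Function.Injective pred := fun a b hab => by
    have := Fin.mk.inj hab
    omega
  calc d = (Set.range pred).ncard := by
        rw [Set.ncard_range_of_injective hpred, Nat.card_eq_fintype_card, Fintype.card_fin]
    _ ≤ _ := Set.ncard_le_ncard <| Set.range_subset_iff.2 fun a => by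
        have hlt : pred a < i := show (i : ℕ) - 1 - a < i by omega
        exact ⟨hlt, hlt, show (i : ℕ) ≤ i - 1 - a + d by omega⟩

section SlidingPath

variable {d n : ℕ} {i : Fin n} {a : Fin d}

lemma add_mul_lt_of_lt_div_add_one (ha : (a : ℕ) < i) {t : ℕ} (ht : t < (i - 1 - a) / d + 1) :
    a + t * d < i := by
  have := (Nat.mul_le_mul_right d (Nat.lt_succ_iff.1 ht)).trans (Nat.div_mul_le_self _ _)
  omega

/-- The path from the dealer to participant `i` through the preceding participants that are
congruent to `a` modulo `d`; the two ends are left out. -/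
def slidingPath (i : Fin n) (a : Fin d) (ha : (a : ℕ) < i) : List (Fin n) :=
  List.ofFn fun t : Fin ((i - 1 - a) / d + 1) =>
    ⟨a + t * d, (add_mul_lt_of_lt_div_add_one ha t.2).trans i.2⟩

lemma lt_of_mem_slidingPath {ha : (a : ℕ) < i} {j : Fin n} (hj : j ∈ slidingPath i a ha) :
    j < i := by
  obtain ⟨t, rfl⟩ := List.mem_ofFn.1 hj
  exact add_mul_lt_of_lt_div_add_one ha t.2

lemma mod_eq_of_mem_slidingPath {ha : (a : ℕ) < i} {j : Fin n} (hj : j ∈ slidingPath i a ha) :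
    (j : ℕ) % d = a := by
  obtain ⟨t, rfl⟩ := List.mem_ofFn.1 hj
  simp only [Nat.add_mul_mod_self_right, Nat.mod_eq_of_lt a.2]

lemma nodup_slidingPath_append (ha : (a : ℕ) < i) : (slidingPath i a ha ++ [i]).Nodup := by
  refine List.nodup_append.2 ⟨List.nodup_ofFn.2 fun s t hst => ?_, List.nodup_singleton i, ?_⟩
  · have hmul : (s : ℕ) * d = t * d := Nat.add_left_cancel (Fin.mk.inj hst)
    exact Fin.ext (Nat.eq_of_mul_eq_mul_right a.pos hmul)
  · rintro j hj _ hi rfl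
    exact (lt_of_mem_slidingPath hj).ne (List.mem_singleton.1 hi)

lemma isChain_slidingPath (ha : (a : ℕ) < i) :
    List.IsChain (slidingNetwork d n).Adj (none :: (slidingPath i a ha ++ [i]).map some) := by
  rw [List.isChain_cons, List.isChain_map, List.isChain_append]
  refine ⟨by simp [slidingPath, slidingNetwork], ?_, List.isChain_singleton i, ?_⟩
  · refine List.isChain_ofFn.2 fun t _ => ⟨?_, ?_⟩
    · simp [Fin.lt_def, a.pos]
    · simp [add_mul, add_assoc]
  · intro x hx y hy
    obtain rfl : i = y := by simpa using hy
    have hx' : x ∈ slidingPath i a ha := List.mem_of_mem_getLast? hx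
    refine ⟨lt_of_mem_slidingPath hx', ?_⟩
    obtain rfl : _ = x := by
      simpa [slidingPath, List.getLast?_eq_getElem?, -List.ofFn_succ] using hx
    have := Nat.lt_div_mul_add (a := (i : ℕ) - 1 - a) a.pos
    change (i : ℕ) ≤ a + (i - 1 - a) / d * d + d
    omega

end SlidingPath

/-- The `d` node-disjoint paths through the `d` residue classes modulo `d` to a participant that is
not connected to the dealer. -/
def slidingRoutes {k d n : ℕ} (hkd : k ≤ d) {i : Fin n} (hi : d ≤ i) :
    Routes (slidingNetwork d n) k i where
  w := d
  le_w := hkd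
  mid a := slidingPath i a (a.2.trans_le hi)
  isPath _ := isChain_slidingPath _
  nodup _ := nodup_slidingPath_append _
  disjoint _ _ hab _ hxa hxb :=
    hab (Fin.ext ((mod_eq_of_mem_slidingPath hxa).symm.trans (mod_eq_of_mem_slidingPath hxb)))

theorem comm_slidingNetwork_le {k d n : ℕ} (hk : 1 ≤ k) (hkd : k ≤ d) (S : SotaSetup n k) :
    S.comm (slidingNetwork d n) ≤ d * (n : ℝ≥0∞) ^ 2 :=
  S.comm_le (hk.trans hkd) fun _ hi => ⟨slidingRoutes hkd (not_lt.1 hi), le_rfl⟩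

lemma div_add_one_le_of_adj_slidingNetwork {d n : ℕ} {u v : Option (Fin n)}
    (huv : (slidingNetwork d n).Adj u v) :
    (v.elim 0 fun j => (j : ℕ) / d + 1) ≤ (u.elim 0 fun j => (j : ℕ) / d + 1) + 1 := by
  match u, v, huv with
  | none, some j, (hj : (j : ℕ) < d) => simp [Nat.div_eq_of_lt hj]
  | some i, some j, hij =>
    have hd : 0 < d := by have := hij.1; have := hij.2; omega
    simpa [Nat.add_div_right _ hd] using Nat.div_le_div_right (c := d) hij.2

lemma sq_le_two_mul_mul_sum_div_add_one {d : ℕ} (hd : 0 < d) (n : ℕ) :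
    n ^ 2 ≤ 2 * d * ∑ i ∈ Finset.range n, (i / d + 1) := by
  induction n with
  | zero => simp
  | succ n ih =>
    have := Nat.lt_mul_div_succ n hd
    rw [Finset.sum_range_succ]
    nlinarith

theorem sq_le_mul_comm_slidingNetwork {k d n : ℕ} (hk : 1 ≤ k) (hd : 0 < d) (S : SotaSetup n k) :
    (n : ℝ≥0∞) ^ 2 ≤ 2 * d * S.comm (slidingNetwork d n) := by
  have hcomm := S.sum_le_comm hk (f := fun v => v.elim 0 fun j => (j : ℕ) / d + 1) rfl
    fun _ _ => div_add_one_le_of_adj_slidingNetwork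
  simp only [Option.elim_some, Fin.sum_univ_eq_sum_range fun i => i / d + 1] at hcomm
  calc (n : ℝ≥0∞) ^ 2 ≤ 2 * d * (∑ i ∈ Finset.range n, (i / d + 1) : ℕ) := by
        exact_mod_cast sq_le_two_mul_mul_sum_div_add_one hd n
    _ ≤ 2 * d * S.comm (slidingNetwork d n) := by gcongr

end SecretSharing

theorem mainTheorem6_general (k d : ℕ) (hk : 1 ≤ k) (hd : k ≤ d) :
    (∃ c C K : ℝ, 0 < c ∧ 0 < C ∧ 0 < K ∧
      ∀ (n : ℕ), k ≤ n → ∀ G : SecretSharing.Network n, SecretSharing.PropagatingDealer G d →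
        ∀ S : SecretSharing.SneakSetup n k d,
          (∃ log, S.CompleteRun G log) ∧
          ∀ log, S.CompleteRun G log →
            c * n ≤ S.comm log ∧ S.comm log ≤ C * n ∧
            ∀ P : SecretSharing.Protocol n, P.IsSecretSharing G k →
              S.comm log ≤ K * P.comm G) ∧
    (∀ N : ℕ → ℕ, Tendsto N atTop atTop →
      ∀ G : ∀ m, SecretSharing.Network (N m),
        (∀ δ : ℝ, 0 < δ → (fun m => (SecretSharing.maxOutDegree (G m) : ℝ)) =O[atTop]
          fun m => (N m : ℝ) ^ δ) →
        ∀ S : ∀ m, SecretSharing.SotaSetup (N m) k,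
          Tendsto (fun m => (S m).comm (G m) / (N m : ℝ≥0∞)) atTop (𝓝 ⊤)) ∧
    (∃ 𝒞 : ∀ n, Set (SecretSharing.Network n), (∀ n, (𝒞 n).Nonempty) ∧
      ∃ c C : ℝ≥0, 0 < c ∧ ∀ n, ∀ G ∈ 𝒞 n, SecretSharing.PropagatingDealer G d ∧
        ∀ S : SecretSharing.SotaSetup n k,
          (c : ℝ≥0∞) * (n : ℝ≥0∞) ^ 2 ≤ S.comm G ∧
          S.comm G ≤ (C : ℝ≥0∞) * (n : ℝ≥0∞) ^ 2) := by
  have hd0 : 0 < d := hk.trans hd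
  refine ⟨⟨d / ((d - k + 1 : ℕ) : ℝ), d / ((d - k + 1 : ℕ) : ℝ), 2 * d / ((d - k + 1 : ℕ) : ℝ),
    by positivity, by positivity, by positivity, fun n hn G hG S => ⟨S.exists_completeRun G,
      fun log h => ⟨(h.comm_eq hG).ge, (h.comm_eq hG).le, fun P => h.comm_le_mul_comm hn hG⟩⟩⟩,
    fun N hN G hG => SecretSharing.tendsto_comm_div_nhds_top hk hN hG,
    fun n => {SecretSharing.slidingNetwork d n}, fun n => Set.singleton_nonempty _,
    (2 * d : ℝ≥0)⁻¹, d, by positivity, ?_⟩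
  rintro n _ rfl
  refine ⟨SecretSharing.propagatingDealer_slidingNetwork d n, fun S => ⟨?_, ?_⟩⟩
  · have hsq := SecretSharing.sq_le_mul_comm_slidingNetwork hk hd0 S
    rw [ENNReal.coe_inv (by positivity), mul_comm, ← div_eq_mul_inv]
    exact ENNReal.div_le_of_le_mul' (by simpa using hsq)
  · simpa using SecretSharing.comm_slidingNetwork_le hk hd S

theorem mainTheorem6 (k d : ℕ) (hk : 2 ≤ k) (hd : k ≤ d) :
    -- SNEAK: linear communication, within a constant factor of every secret sharing algorithm
    (∃ c C K : ℝ, 0 < c ∧ 0 < C ∧ 0 < K ∧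
      ∀ (n : ℕ), k ≤ n → ∀ G : SecretSharing.Network n, SecretSharing.PropagatingDealer G d →
        ∀ S : SecretSharing.SneakSetup n k d,
          (∃ log, S.CompleteRun G log) ∧
          ∀ log, S.CompleteRun G log →
            c * n ≤ S.comm log ∧ S.comm log ≤ C * n ∧
            ∀ P : SecretSharing.Protocol n, P.IsSecretSharing G k →
              S.comm log ≤ K * P.comm G) ∧
    -- separate secure transmissions: super-linear when the outgoing degrees grow slowly
    (∀ ε : ℝ, 0 < ε → ∀ N : ℕ → ℕ, Tendsto N atTop atTop →
      ∀ G : ∀ m, SecretSharing.Network (N m),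
        (fun m => (SecretSharing.maxOutDegree (G m) : ℝ)) =O[atTop]
          (fun m => Real.log (N m) ^ (1 / 2 - ε)) →
        ∀ S : ∀ m, SecretSharing.SotaSetup (N m) k,
          Tendsto (fun m => (S m).comm (G m) / (N m : ℝ≥0∞)) atTop (𝓝 ⊤)) ∧
    -- separate secure transmissions: quadratic on a class of networks
    (∃ 𝒞 : ∀ n, Set (SecretSharing.Network n), (∀ n, d < n → (𝒞 n).Nonempty) ∧
      ∃ c C : ℝ≥0, 0 < c ∧ ∀ n, d < n → ∀ G ∈ 𝒞 n, SecretSharing.PropagatingDealer G d ∧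
        ∀ S : SecretSharing.SotaSetup n k,
          (c : ℝ≥0∞) * (n : ℝ≥0∞) ^ 2 ≤ S.comm G ∧
          S.comm G ≤ (C : ℝ≥0∞) * (n : ℝ≥0∞) ^ 2) := by
  obtain ⟨hsneak, hslow, 𝒞, h𝒞, c, C, hc, hquad⟩ := mainTheorem6_general k d (by omega) hd
  exact ⟨hsneak, fun ε _ N hN G hG => hslow N hN G fun δ hδ => hG.trans
    ((isLittleO_log_rpow_rpow_atTop (1 / 2 - ε) hδ).isBigO.comp_tendsto
      (tendsto_natCast_atTop_atTop.comp hN)), 𝒞, fun n _ => h𝒞 n, c, C, hc, fun n _ => hquad n⟩
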